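/- Let $b\ge 2$ be an integer and $\omega_b=\exp(2\pi\sqrt{-1}/b)$. Let $k\ge 1$ be an integer with $b$-adic expansion $k=\kappa_1b^{a_1-1}+\cdots+\kappa_vb^{a_v-1}$, where $0<\kappa_i\le b-1$ and $a_1>\cdots>a_v\ge 1$. For $x\in[0,1)$ with $b$-adic expansion $x=\xi_1b^{-1}+\xi_2b^{-2}+\cdots$ (with infinitely many digits $\xi_i\neq b-1$) let $\mathrm{wal}_k(x)=\omega_b^{\sum_{i=1}^v\kappa_i\xi_{a_i}}$ be the $k$-th $b$-adic Walsh function, and let $\widehat f(k)=\int_0^1 f(x)\overline{\mathrm{wal}_k(x)}\,dx$. Put $$m_b=\min_{1\le c\le b-1}|1-\overline{\omega_b}^{\,c}|,\qquad M_b=\max_{1\le c\le b-1}|1-\overline{\omega_b}^{\,c}|,$$ and, for an integer $\alpha\ge 1$, $$\mu_{\alpha,\mathrm{per}}(k)=\begin{cases}a_1+\cdots+a_v+(\alpha-v)a_v & \text{if } v\le\alpha,\\ a_1+\cdots+a_\alpha & \text{if } v\ge\alpha.\end{cases}$$ Theorem. Let $\alpha$ and $k$ be positive integers. Let $f\colon[0,1]\to\mathbb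 R$ be such that $f^{(i)}$ is absolutely continuous and $\int_0^1 f^{(i)}(x)\,dx=0$ for all $0\le i<\alpha$, and $f^{(\alpha)}\in L^2[0,1]$. If $b>2$, then $$|\widehat f(k)|\le \int_0^1|f^{(\alpha)}(x)|\,dx\;\frac{b^{-\mu_{\alpha,\mathrm{per}}(k)}}{m_b^{\alpha}}\,M_b\left(1+\frac{b\,m_b}{b-M_b}\left(1-\left(\frac{M_b}{b}\right)^{v}\right)\right).$$ If $b=2$, then $$|\widehat f(k)|\le \int_0^1|f^{(\alpha)}(x)|\,dx\;\frac{2^{-\mu_{\alpha,\mathrm{per}}(k)}}{2^{\alpha-1}}.$$ -/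

import Mathlib

open MeasureTheory Set
open scoped ComplexConjugate

noncomputable section

namespace Walsh

/-- The digit of `k` in base `b` that multiplies `b ^ (a - 1)` (for `a ≥ 1`). -/
def natDigit (b k a : ℕ) : ℕ := (Nat.digits b k).getD (a - 1) 0

/-- The set `{a_1, …, a_v}` of the positions (counted from `1`) of the nonzero digits in the
`b`-adic expansion `k = κ_1 b ^ (a_1 - 1) + ⋯ + κ_v b ^ (a_v - 1)`. -/
def positions (b k : ℕ) : Finset ℕ :=
  (Finset.Icc 1 (Nat.digits b k).length).filter fun a => natDigit b k a ≠ 0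

/-- The number `v` of nonzero `b`-adic digits of `k`. -/
def hammingWeight (b k : ℕ) : ℕ := (positions b k).card

/-- `position b k i` is `a_i`, for `1 ≤ i ≤ v`, where `a_1 > a_2 > ⋯ > a_v ≥ 1`. -/
def position (b k i : ℕ) : ℕ := ((positions b k).sort (· ≥ ·)).getD (i - 1) 0

/-- The quantity `μ_{α,per}(k)` in base `b`. -/
def muPer (b α k : ℕ) : ℕ :=
  if k = 0 then 0
  else if hammingWeight b k ≤ α then
    (∑ i ∈ Finset.Icc 1 (hammingWeight b k), position b k i)
      + (α - hammingWeight b k) * position b k (hammingWeight b k)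
  else ∑ i ∈ Finset.Icc 1 α, position b k i

/-- `ω_b = exp (2 π i / b)`. -/
def omega (b : ℕ) : ℂ := Complex.exp (2 * Real.pi * Complex.I / b)

/-- The digit `ξ_a` (for `a ≥ 1`) of `x = ξ_1 b⁻¹ + ξ_2 b⁻² + ⋯ ∈ [0, 1)`, for the expansion in
which infinitely many digits differ from `b - 1`. -/
def realDigit (b : ℕ) (x : ℝ) (a : ℕ) : ℕ := ⌊x * (b : ℝ) ^ a⌋₊ % b

/-- The `k`-th `b`-adic Walsh function, for `x ∈ [0, 1)`. -/
def wal (b k : ℕ) (x : ℝ) : ℂ :=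
  omega b ^ ∑ a ∈ positions b k, natDigit b k a * realDigit b x a

/-- The `k`-th `b`-adic Walsh coefficient of `f : [0, 1) → ℂ`. -/
def coeff (b k : ℕ) (f : ℝ → ℂ) : ℂ :=
  ∫ x in Ico (0 : ℝ) 1, f x * conj (wal b k x)

/-- `m_b`, the minimum over `1 ≤ c ≤ b - 1` of `|1 - conj ω_b ^ c|`. -/
def mConst (b : ℕ) : ℝ :=
  sInf ((fun c : ℕ => ‖1 - conj (omega b) ^ c‖) '' Icc 1 (b - 1))

/-- `M_b`, the maximum over `1 ≤ c ≤ b - 1` of `|1 - conj ω_b ^ c|`. -/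
def MConst (b : ℕ) : ℝ :=
  sSup ((fun c : ℕ => ‖1 - conj (omega b) ^ c‖) '' Icc 1 (b - 1))

/-- The `i`-th derivative `f⁽ⁱ⁾` on `[0, 1]`, one-sided at the end points.  Only the values of `f`
on `[0, 1]` matter for its values there. -/
def der (i : ℕ) (f : ℝ → ℝ) : ℝ → ℝ := iteratedDerivWithin i f (Icc 0 1)

/-- The Sobolev space of the functions `f : [0, 1] → ℝ` such that `f⁽ⁱ⁾` is absolutely continuous
for `0 ≤ i < α`, and `f⁽ᵅ⁾`, which then exists almost everywhere, is in `L²[0, 1]`. -/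
structure IsSobolev (α : ℕ) (f : ℝ → ℝ) : Prop where
  absolutelyContinuous : ∀ i < α, AbsolutelyContinuousOnInterval (der i f) 0 1
  memLp : MemLp (der α f) 2 (volume.restrict (Icc 0 1))

/-- The periodic Sobolev space: in addition, `∫₀¹ f⁽ⁱ⁾ = 0` for `0 ≤ i < α`. -/
structure IsSobolevPer (α : ℕ) (f : ℝ → ℝ) : Prop extends IsSobolev α f where
  integral_eq_zero : ∀ i < α, ∫ x in (0 : ℝ)..1, der i f x = 0

end Walsh

end

/-!
Since `f⁽ⁱ⁾` has mean zero for `i < α`, integrating by parts `α` times turns `|f̂(k)|` into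
`|∫ f⁽ᵅ⁾ Tᵅ K|`, where `K` is the conjugate of `wal_k` and `T` maps a function to the primitive of
the function minus its mean, so it is enough to bound `Tᵅ K` uniformly.

The function `K` is a product of step characters `x ↦ z ^ ⌊x bᵃ⌋`, one for each `a = a_1, …, a_v`.
A function multiplied by a root of unity `z ≠ 1` under the shift by `L = b⁻ᵃ` has mean zero on all
coarser cells, on which the characters of smaller levels are constant. Hence `T` acts on the finest
character only. Its primitive is again quasi-periodic up to an additive constant, so that it can be
multiplied by the next character and integrated in the same way. Each step gains the factor
`L / |1 - z| ≤ L / m_b`, and the error relative to the mean decays geometrically, with ratio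
`M_b / b`. Once the characters are used up, each further application of `T` gains `b^{-a_v} / m_b`.

In base `2` the iterated primitives are real with values in `[0, 2 A]`, where `A` is their mean.
This replaces the geometric sum by the constant `2`.
-/

noncomputable section

namespace Walsh

section Cells

/-- A function constant on every cell `[n L, (n + 1) L)` of length `L`. -/
def CellConst {β : Type*} (L : ℝ) (h : ℝ → β) : Prop := ∀ ⦃x y⦄, ⌊x / L⌋ = ⌊y / L⌋ → h x = h y

theorem floor_div_eq_iff {L : ℝ} (hL : 0 < L) {n : ℤ} {x : ℝ} :
    ⌊x / L⌋ = n ↔ x ∈ Ico (n * L) (n * L + L) := by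
  rw [Int.floor_eq_iff, le_div_iff₀ hL, div_lt_iff₀ hL, add_one_mul, mem_Ico]

theorem CellConst.of_natCast_mul {β : Type*} {L : ℝ} (n : ℕ) {h : ℝ → β}
    (hh : CellConst (n * L) h) : CellConst L h := by
  intro x y hxy
  apply hh
  rw [mul_comm, ← div_div, ← div_div, Int.floor_div_natCast, Int.floor_div_natCast, hxy]

theorem intervalIntegrable_bdd_mul {F h : ℝ → ℂ} {s t : ℝ} (hF : IntervalIntegrable F volume s t)
    (hh : Measurable h) {C : ℝ} (hC : ∀ x, ‖h x‖ ≤ C) :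
    IntervalIntegrable (fun x => h x * F x) volume s t := by
  rw [intervalIntegrable_iff] at hF ⊢
  exact hF.bdd_mul hh.aestronglyMeasurable (.of_forall hC)

theorem integral_cell_multiple_eq_zero {F : ℝ → ℂ} {L : ℝ}
    (hF : ∀ s t, IntervalIntegrable F volume s t)
    (h0 : ∀ n : ℤ, ∫ x in (n * L)..(n * L + L), F x = 0) (n : ℤ) :
    ∫ x in (0 : ℝ)..(n * L), F x = 0 := by
  have hstep (n : ℤ) :
      ∫ x in (0 : ℝ)..((n + 1 : ℤ) * L), F x = ∫ x in (0 : ℝ)..(n * L), F x := by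
    rw [← intervalIntegral.integral_add_adjacent_intervals (hF 0 (n * L)) (hF _ _)]
    simp [add_one_mul, h0 n]
  induction n using Int.induction_on with
  | zero => simp
  | succ n ih => rw [hstep, ih]
  | pred n ih => rw [← hstep, sub_add_cancel, ih]

theorem integral_cellConst_mul_of_mem_cell {F h : ℝ → ℂ} {L : ℝ} (hL : 0 < L)
    (hh : CellConst L h) {n : ℤ} {y : ℝ} (hy : y ∈ Icc (n * L) (n * L + L)) :
    ∫ t in (n * L)..y, h t * F t = h (n * L) * ∫ t in (n * L)..y, F t := by
  rw [← intervalIntegral.integral_const_mul]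
  refine intervalIntegral.integral_congr_Ioo_of_le hy.1 fun t ht => ?_
  have hcell : ⌊t / L⌋ = ⌊n * L / L⌋ := by
    rw [(floor_div_eq_iff hL).2 ⟨ht.1.le, ht.2.trans_le hy.2⟩, mul_div_cancel_right₀ _ hL.ne',
      Int.floor_intCast]
  simp only [hh hcell]

theorem integral_cellConst_mul {F h : ℝ → ℂ} {L : ℝ} (hL : 0 < L)
    (hF : ∀ s t, IntervalIntegrable F volume s t)
    (hhF : ∀ s t, IntervalIntegrable (fun x => h x * F x) volume s t) (hh : CellConst L h)
    (h0 : ∀ n : ℤ, ∫ x in (n * L)..(n * L + L), F x = 0) (x : ℝ) :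
    ∫ t in (0 : ℝ)..x, h t * F t = h x * ∫ t in (0 : ℝ)..x, F t := by
  have hhF0 (n : ℤ) : ∫ t in (n * L)..(n * L + L), h t * F t = 0 := by
    rw [integral_cellConst_mul_of_mem_cell hL hh (right_mem_Icc.2 (by linarith)), h0, mul_zero]
  set n := ⌊x / L⌋ with hn
  have hx := (floor_div_eq_iff hL).1 hn.symm
  have hhx : h (n * L) = h x := hh <| by rw [mul_div_cancel_right₀ _ hL.ne', Int.floor_intCast]
  rw [← intervalIntegral.integral_add_adjacent_intervals (hhF 0 (n * L)) (hhF _ x),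
    ← intervalIntegral.integral_add_adjacent_intervals (hF 0 (n * L)) (hF _ x),
    integral_cell_multiple_eq_zero hhF hhF0, integral_cell_multiple_eq_zero hF h0, zero_add,
    zero_add, integral_cellConst_mul_of_mem_cell hL hh (Ico_subset_Icc_self hx), hhx]

end Cells

section QuasiPeriodic

/-- Functions that are multiplied by `z` when the argument is shifted by `L`. -/
def QuasiPeriodic (L : ℝ) (z : ℂ) (F : ℝ → ℂ) : Prop := ∀ x, F (x + L) = z * F x

/-- The constant that has to be subtracted from the primitive `x ↦ ∫₀ˣ H` of a quasi-periodic
function `H` with multiplier `z ≠ 1` to make it quasi-periodic again. -/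
def primCenter (L : ℝ) (z : ℂ) (H : ℝ → ℂ) : ℂ := (1 - z)⁻¹ * ∫ t in (0 : ℝ)..L, H t

namespace QuasiPeriodic

variable {L : ℝ} {z : ℂ} {F : ℝ → ℂ}

theorem map_add_natCast_mul (hF : QuasiPeriodic L z F) (n : ℕ) (x : ℝ) :
    F (x + n * L) = z ^ n * F x := by
  induction n with
  | zero => simp
  | succ n ih =>
    rw [Nat.cast_succ, add_one_mul, ← add_assoc, hF, ih, pow_succ']
    ring

theorem map_add_intCast_mul (hF : QuasiPeriodic L z F) (hz : z ≠ 0) (n : ℤ) (x : ℝ) :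
    F (x + n * L) = z ^ n * F x := by
  obtain ⟨n, rfl | rfl⟩ := n.eq_nat_or_neg
  · simpa using hF.map_add_natCast_mul n x
  · have h := hF.map_add_natCast_mul n (x + ((-n : ℤ) : ℝ) * L)
    rw [Int.cast_neg, Int.cast_natCast, neg_mul, neg_add_cancel_right] at h
    rw [Int.cast_neg, Int.cast_natCast, neg_mul, h, zpow_neg, zpow_natCast,
      inv_mul_cancel_left₀ (pow_ne_zero n hz)]

theorem periodic (hF : QuasiPeriodic L z F) {b : ℕ} (hb : z ^ b = 1) (n : ℕ) :
    Function.Periodic F (n * (b * L)) := by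
  intro x
  have h := hF.map_add_natCast_mul (b * n) x
  rw [pow_mul, hb, one_pow, one_mul] at h
  rw [← h]
  push_cast
  ring_nf

theorem integral_add_add (hF : QuasiPeriodic L z F) (s t : ℝ) :
    ∫ x in (s + L)..(t + L), F x = z * ∫ x in s..t, F x := by
  rw [← intervalIntegral.integral_comp_add_right, ← intervalIntegral.integral_const_mul]
  simp_rw [hF _]

/-- Shifting by `L` multiplies the integral over a period by `z`, but does not change it. -/
theorem integral_period_eq_zero (hF : QuasiPeriodic L z F) (hz : z ≠ 1) {b : ℕ} (hb : z ^ b = 1)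
    (n : ℕ) (s : ℝ) : ∫ x in s..(s + n * (b * L)), F x = 0 := by
  have hinvariant := (hF.periodic hb n).intervalIntegral_add_eq s (s + L)
  rw [add_right_comm, hF.integral_add_add] at hinvariant
  have hmul : (1 - z) * ∫ x in s..(s + n * (b * L)), F x = 0 := by linear_combination hinvariant
  exact (mul_eq_zero.1 hmul).resolve_left (sub_ne_zero.2 hz.symm)

theorem integral_sub_primCenter_eq (hF : QuasiPeriodic L z F)
    (hi : ∀ s t, IntervalIntegrable F volume s t) (hz : z ≠ 1) (x : ℝ) :
    (∫ t in (0 : ℝ)..x, F t) - primCenter L z F = -((1 - z)⁻¹ * ∫ t in x..(x + L), F t) := by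
  have hadd : (∫ t in (0 : ℝ)..x, F t) + ∫ t in x..(x + L), F t =
      (∫ t in (0 : ℝ)..L, F t) + z * ∫ t in (0 : ℝ)..x, F t := by
    rw [← hF.integral_add_add, zero_add, intervalIntegral.integral_add_adjacent_intervals
      (hi _ _) (hi _ _), intervalIntegral.integral_add_adjacent_intervals (hi _ _) (hi _ _)]
  have hz' : 1 - z ≠ 0 := sub_ne_zero.2 hz.symm
  rw [primCenter]
  field_simp
  linear_combination hadd

theorem integral_sub_primCenter (hF : QuasiPeriodic L z F)
    (hi : ∀ s t, IntervalIntegrable F volume s t) (hz : z ≠ 1) :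
    QuasiPeriodic L z fun x => (∫ t in (0 : ℝ)..x, F t) - primCenter L z F := by
  intro x
  simp only [hF.integral_sub_primCenter_eq hi hz, hF.integral_add_add]
  ring

theorem integral_add_intCast_mul_eq (hF : QuasiPeriodic L z F)
    (hi : ∀ s t, IntervalIntegrable F volume s t) (hz : z ≠ 1) (hz0 : z ≠ 0) (n : ℤ) (y : ℝ) :
    ∫ t in (0 : ℝ)..(y + n * L), F t = (1 - z)⁻¹ *
      ((1 - z ^ (n + 1)) * (∫ t in (0 : ℝ)..y, F t) + (1 - z ^ n) * ∫ t in y..L, F t) := by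
  have hshift := (hF.integral_sub_primCenter hi hz).map_add_intCast_mul hz0 n y
  have hsplit : ∫ t in (0 : ℝ)..L, F t = (∫ t in (0 : ℝ)..y, F t) + ∫ t in y..L, F t :=
    (intervalIntegral.integral_add_adjacent_intervals (hi _ _) (hi _ _)).symm
  have hz' : 1 - z ≠ 0 := sub_ne_zero.2 hz.symm
  rw [sub_eq_iff_eq_add.1 hshift, primCenter, hsplit, zpow_add_one₀ hz0]
  field_simp
  ring

variable {m M B : ℝ}

theorem norm_integral_sub_primCenter_le (hF : QuasiPeriodic L z F)
    (hi : ∀ s t, IntervalIntegrable F volume s t) (hz : z ≠ 1) (hL : 0 ≤ L)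
    (hm : 0 < m) (hmz : m ≤ ‖1 - z‖) (hB : ∀ x, ‖F x‖ ≤ B) (x : ℝ) :
    ‖(∫ t in (0 : ℝ)..x, F t) - primCenter L z F‖ ≤ L * B / m := by
  have hint : ‖∫ t in x..(x + L), F t‖ ≤ B * L := by
    simpa [abs_of_nonneg hL] using
      intervalIntegral.norm_integral_le_of_norm_le_const (a := x) (b := x + L) fun t _ => hB t
  rw [hF.integral_sub_primCenter_eq hi hz, norm_neg, norm_mul, norm_inv, ← div_eq_inv_mul,
    mul_comm L]
  gcongr
  exact (norm_nonneg _).trans hint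

theorem norm_integral_le (hF : QuasiPeriodic L z F)
    (hi : ∀ s t, IntervalIntegrable F volume s t) (hz : z ≠ 1) (hz0 : z ≠ 0) (hL : 0 < L)
    (hm : 0 < m) (hmz : m ≤ ‖1 - z‖) (hM : ∀ n : ℤ, ‖1 - z ^ n‖ ≤ M) (hB : ∀ x, ‖F x‖ ≤ B)
    (x : ℝ) : ‖∫ t in (0 : ℝ)..x, F t‖ ≤ M / m * (L * B) := by
  have : 0 ≤ B := (norm_nonneg _).trans (hB 0)
  have hM0 : 0 ≤ M := (norm_nonneg _).trans (hM 0)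
  have hint {s t : ℝ} (hst : s ≤ t) : ‖∫ u in s..t, F u‖ ≤ B * (t - s) := by
    simpa [abs_of_nonneg (sub_nonneg.2 hst)] using
      intervalIntegral.norm_integral_le_of_norm_le_const (a := s) (b := t) fun u _ => hB u
  obtain ⟨hx0, hx1⟩ := (floor_div_eq_iff hL (x := x)).1 rfl
  obtain ⟨y, hy⟩ : ∃ y, x = y + ⌊x / L⌋ * L := ⟨x - ⌊x / L⌋ * L, by ring⟩
  have hleft := hint (show 0 ≤ y by linarith)
  have hright := hint (show y ≤ L by linarith)
  rw [hy, hF.integral_add_intCast_mul_eq hi hz hz0, norm_mul, norm_inv]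
  calc _ ≤ m⁻¹ * (M * (B * (y - 0)) + M * (B * (L - y))) := by
        gcongr
        refine (norm_add_le _ _).trans ?_
        rw [norm_mul, norm_mul]
        gcongr <;> exact hM _
    _ = M / m * (L * B) := by ring

end QuasiPeriodic

end QuasiPeriodic

section StepChar

/-- The step character `x ↦ z ^ ⌊x / L⌋`. For `L = b⁻ᵃ` and a `b`-th root of unity `z`, it
depends only on the `a`-th `b`-adic digit of `x`. -/
def stepChar (z : ℂ) (L x : ℝ) : ℂ := z ^ ⌊x / L⌋

theorem cellConst_stepChar (z : ℂ) (L : ℝ) : CellConst L (stepChar z L) :=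
  fun _ _ h => congrArg (z ^ ·) h

theorem quasiPeriodic_stepChar {z : ℂ} (hz : z ≠ 0) {L : ℝ} (hL : L ≠ 0) :
    QuasiPeriodic L z (stepChar z L) := by
  intro x
  rw [stepChar, add_div, div_self hL, Int.floor_add_one, zpow_add_one₀ hz, mul_comm, stepChar]

theorem stepChar_of_mem_Ico (z : ℂ) {L x : ℝ} (hx : x ∈ Ico 0 L) : stepChar z L x = 1 := by
  have hfloor : ⌊x / L⌋ = 0 := (floor_div_eq_iff (hx.1.trans_lt hx.2)).2 (by simpa using hx)
  rw [stepChar, hfloor, zpow_zero]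

theorem norm_stepChar {z : ℂ} (hz : ‖z‖ = 1) (L x : ℝ) : ‖stepChar z L x‖ = 1 := by
  rw [stepChar, norm_zpow, hz, one_zpow]

@[fun_prop]
theorem measurable_stepChar (z : ℂ) (L : ℝ) : Measurable (stepChar z L) :=
  (measurable_from_top (f := fun n : ℤ => z ^ n)).comp
    (Int.measurable_floor.comp (measurable_id.div_const L))

/-- The primitive, vanishing at `0`, of `W` times a step character. -/
def stepPrim (z : ℂ) (L : ℝ) (W : ℝ → ℂ) (x : ℝ) : ℂ :=
  ∫ t in (0 : ℝ)..x, stepChar z L t * W t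

theorem stepPrim_eq_integral (z : ℂ) {L : ℝ} (W : ℝ → ℂ) {x : ℝ} (hx : x ∈ Icc 0 L) :
    stepPrim z L W x = ∫ t in (0 : ℝ)..x, W t :=
  intervalIntegral.integral_congr_Ioo_of_le hx.1 fun t ht => by
    simp only [stepChar_of_mem_Ico z ⟨ht.1.le, ht.2.trans_le hx.2⟩, one_mul]

theorem intervalIntegrable_stepChar_mul {z : ℂ} (hz : ‖z‖ = 1) (L : ℝ) {W : ℝ → ℂ} {s t : ℝ}
    (hW : IntervalIntegrable W volume s t) :
    IntervalIntegrable (fun x => stepChar z L x * W x) volume s t :=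
  intervalIntegrable_bdd_mul hW (measurable_stepChar z L) fun x => (norm_stepChar hz L x).le

end StepChar

/-- The operator of integration by parts for mean-zero functions on `[0, 1]`: the primitive,
vanishing at `0` and at `1`, of `K` minus its mean. -/
def prim {E : Type*} [NormedAddCommGroup E] [NormedSpace ℝ E] (K : ℝ → E) (x : ℝ) : E :=
  ∫ t in (0 : ℝ)..x, (K t - ∫ s in (0 : ℝ)..1, K s)

section Cell

/-- The length `b⁻ᵃ` of the cells on which the first `a` digits in base `b` are constant. -/
def cell (b a : ℕ) : ℝ := ((b : ℝ) ^ a)⁻¹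

theorem cell_zero (b : ℕ) : cell b 0 = 1 := by simp [cell]

theorem cell_add (b a c : ℕ) : cell b (a + c) = cell b a * cell b c := by
  rw [cell, pow_add, mul_inv, cell, cell]

theorem cell_eq_zpow (b a : ℕ) : cell b a = (b : ℝ) ^ (-(a : ℤ)) := by
  rw [cell, zpow_neg, zpow_natCast]

variable {b : ℕ} [NeZero b]

theorem cell_pos (a : ℕ) : 0 < cell b a := by
  have := NeZero.pos b
  unfold cell
  positivity

theorem exists_cell_eq {a' a : ℕ} (h : a' < a) : ∃ n : ℕ, cell b a' = n * (b * cell b a) := by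
  obtain ⟨d, rfl⟩ := Nat.exists_eq_add_of_lt h
  have hb : (b : ℝ) ≠ 0 := NeZero.ne _
  refine ⟨b ^ d, ?_⟩
  simp only [cell, Nat.cast_pow]
  field_simp
  ring

theorem mul_cell_le {a' a : ℕ} (h : a' < a) : b * cell b a ≤ cell b a' := by
  obtain ⟨n, hn⟩ := exists_cell_eq (b := b) h
  have hn0 : n ≠ 0 := by
    rintro rfl
    simp [(cell_pos a').ne'] at hn
  rw [hn]
  have := (cell_pos (b := b) a).le
  exact le_mul_of_one_le_left (by positivity) (by exact_mod_cast Nat.one_le_iff_ne_zero.2 hn0)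

end Cell

section Roots

/-- `z ≠ 1` is a `b`-th root of unity. -/
structure IsNontrivialRoot (b : ℕ) (z : ℂ) : Prop where
  pow_eq_one : z ^ b = 1
  ne_one : z ≠ 1

variable {b : ℕ} {z : ℂ}

theorem IsNontrivialRoot.sum_one_sub_pow (hz : IsNontrivialRoot b z) :
    ∑ j ∈ Finset.range b, (1 - z ^ j) = b := by
  have hzero : (1 - z) * ∑ j ∈ Finset.range b, z ^ j = 0 := by
    rw [mul_neg_geom_sum, hz.pow_eq_one, sub_self]
  rw [Finset.sum_sub_distrib, (mul_eq_zero.1 hzero).resolve_left (sub_ne_zero.2 hz.ne_one.symm)]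
  simp

variable [NeZero b]

theorem IsNontrivialRoot.two_le (hz : IsNontrivialRoot b z) : 2 ≤ b := by
  refine (Nat.two_le_iff b).2 ⟨NeZero.ne b, ?_⟩
  rintro rfl
  exact hz.ne_one (by simpa using hz.pow_eq_one)

theorem IsNontrivialRoot.norm_eq_one (hz : IsNontrivialRoot b z) : ‖z‖ = 1 :=
  Complex.norm_eq_one_of_pow_eq_one hz.pow_eq_one (NeZero.ne b)

theorem IsNontrivialRoot.ne_zero (hz : IsNontrivialRoot b z) : z ≠ 0 :=
  norm_ne_zero_iff.1 (hz.norm_eq_one ▸ one_ne_zero)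

theorem IsNontrivialRoot.two_le_mul_norm_one_sub (hz : IsNontrivialRoot b z) :
    2 ≤ b * ‖1 - z‖ := by
  have hb : (0 : ℝ) < b := mod_cast NeZero.pos b
  have hpow (j : ℕ) : ‖1 - z ^ j‖ ≤ ‖1 - z‖ * j := by
    rw [← mul_neg_geom_sum, norm_mul]
    gcongr
    refine (norm_sum_le _ _).trans ?_
    simp [hz.norm_eq_one]
  have hsum : (b : ℝ) ≤ ‖1 - z‖ * ∑ j ∈ Finset.range b, (j : ℝ) := by
    rw [← Complex.norm_natCast, ← hz.sum_one_sub_pow, Finset.mul_sum]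
    exact (norm_sum_le _ _).trans (Finset.sum_le_sum fun j _ => hpow j)
  have hgauss : (∑ j ∈ Finset.range b, (j : ℝ)) * 2 ≤ b * b := by
    rw [← Nat.cast_sum]
    exact_mod_cast (Finset.sum_range_id_mul_two b).trans_le (Nat.mul_le_mul_left b (b.sub_le 1))
  refine le_of_mul_le_mul_left ?_ hb
  calc (b : ℝ) * 2 ≤ ‖1 - z‖ * ((∑ j ∈ Finset.range b, (j : ℝ)) * 2) := by linarith
    _ ≤ ‖1 - z‖ * (b * b) := by gcongr
    _ = b * (b * ‖1 - z‖) := by ring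

end Roots

section Levels

/-- Up to the additive constant `μ`, the continuous function `W` is quasi-periodic on the scale
`b⁻ᵃ`, its multiplier `z` being a nontrivial root of unity. Then `μ` is the mean of `W` over every
cell of a coarser scale. -/
structure IsLevel (b a : ℕ) (z μ : ℂ) (W : ℝ → ℂ) : Prop extends IsNontrivialRoot b z where
  continuous : Continuous W
  quasiPeriodic : QuasiPeriodic (cell b a) z fun x => W x - μ

theorem isLevel_one {b : ℕ} (a : ℕ) {z : ℂ} (hz : IsNontrivialRoot b z) : IsLevel b a z 1 1 :=
  ⟨hz, continuous_one, fun x => by simp⟩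

namespace IsLevel

variable {b a a' : ℕ} {z z' μ : ℂ} {W : ℝ → ℂ}

theorem intervalIntegrable_sub (hW : IsLevel b a z μ W) (s t : ℝ) :
    IntervalIntegrable (fun x => W x - μ) volume s t :=
  (hW.continuous.sub continuous_const).intervalIntegrable s t

variable [NeZero b]

theorem periodic (hW : IsLevel b a z μ W) (h : a' < a) : Function.Periodic W (cell b a') := by
  obtain ⟨n, hn⟩ := exists_cell_eq (b := b) h
  intro x
  rw [hn]
  exact sub_left_injective (hW.quasiPeriodic.periodic hW.pow_eq_one n x)

theorem integral_sub_eq_zero (hW : IsLevel b a z μ W) (h : a' < a) (s : ℝ) :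
    ∫ x in s..(s + cell b a'), (W x - μ) = 0 := by
  obtain ⟨n, hn⟩ := exists_cell_eq (b := b) h
  rw [hn]
  exact hW.quasiPeriodic.integral_period_eq_zero hW.ne_one hW.pow_eq_one n s

theorem integral_cell (hW : IsLevel b a z μ W) (h : a' < a) :
    ∫ x in (0 : ℝ)..cell b a', W x = cell b a' * μ := by
  have hzero := hW.integral_sub_eq_zero h 0
  rw [zero_add, intervalIntegral.integral_sub (hW.continuous.intervalIntegrable _ _)
    intervalIntegrable_const, sub_eq_zero] at hzero
  simpa using hzero

theorem quasiPeriodic_stepChar_mul (hW : IsLevel b a z μ W) (h : a' < a)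
    (hz' : IsNontrivialRoot b z') :
    QuasiPeriodic (cell b a') z' fun x => stepChar z' (cell b a') x * W x := by
  intro x
  beta_reduce
  rw [hW.periodic h, quasiPeriodic_stepChar hz'.ne_zero (cell_pos a').ne' x, mul_assoc]

theorem intervalIntegrable_stepChar_mul (hW : IsLevel b a z μ W) (hz' : IsNontrivialRoot b z')
    (L s t : ℝ) : IntervalIntegrable (fun x => stepChar z' L x * W x) volume s t :=
  Walsh.intervalIntegrable_stepChar_mul hz'.norm_eq_one L (hW.continuous.intervalIntegrable s t)

theorem primCenter_stepChar_mul (hW : IsLevel b a z μ W) (h : a' < a) (z' : ℂ) :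
    primCenter (cell b a') z' (fun x => stepChar z' (cell b a') x * W x) =
      (1 - z')⁻¹ * (cell b a' * μ) := by
  rw [← hW.integral_cell h, ← stepPrim_eq_integral z' W ⟨(cell_pos a').le, le_rfl⟩]
  rfl

theorem isLevel_stepPrim (hW : IsLevel b a z μ W) (h : a' < a) (hz' : IsNontrivialRoot b z') :
    IsLevel b a' z' ((1 - z')⁻¹ * (cell b a' * μ)) (stepPrim z' (cell b a') W) where
  toIsNontrivialRoot := hz'
  continuous :=
    intervalIntegral.continuous_primitive (hW.intervalIntegrable_stepChar_mul hz' _) 0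
  quasiPeriodic := by
    rw [← hW.primCenter_stepChar_mul h z']
    exact (hW.quasiPeriodic_stepChar_mul h hz').integral_sub_primCenter
      (hW.intervalIntegrable_stepChar_mul hz' _) hz'.ne_one

theorem prim_apply (hW : IsLevel b a z μ W) (ha : 1 ≤ a) (x : ℝ) :
    prim W x = ∫ t in (0 : ℝ)..x, (W t - μ) := by
  have hmean := hW.integral_cell ha
  rw [cell_zero, Complex.ofReal_one, one_mul] at hmean
  rw [prim, hmean]

theorem isLevel_prim (hW : IsLevel b a z μ W) (ha : 1 ≤ a) :
    IsLevel b a z (primCenter (cell b a) z fun x => W x - μ) (prim W) where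
  toIsNontrivialRoot := hW.toIsNontrivialRoot
  continuous := by
    rw [funext (hW.prim_apply ha)]
    exact intervalIntegral.continuous_primitive hW.intervalIntegrable_sub 0
  quasiPeriodic := by
    simp only [hW.prim_apply ha]
    exact hW.quasiPeriodic.integral_sub_primCenter hW.intervalIntegrable_sub hW.ne_one

end IsLevel

end Levels

section CharProd

/-- The product of step characters on the scales `b⁻ᵃ`, `a ∈ l`, with multipliers `ζ a`. -/
def charProd (b : ℕ) (ζ : ℕ → ℂ) (l : List ℕ) (x : ℝ) : ℂ :=
  (l.map fun a => stepChar (ζ a) (cell b a) x).prod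

/-- Integrate `W` once for each scale in `l`, multiplying by the step character of that scale
before each integration. -/
def nestedPrim (b : ℕ) (ζ : ℕ → ℂ) : List ℕ → (ℝ → ℂ) → ℝ → ℂ
  | [], W => W
  | a :: l, W => nestedPrim b ζ l (stepPrim (ζ a) (cell b a) W)

variable {b : ℕ} {ζ : ℕ → ℂ} {l : List ℕ}

theorem charProd_nil (b : ℕ) (ζ : ℕ → ℂ) : charProd b ζ [] = 1 := rfl

theorem charProd_cons (b : ℕ) (ζ : ℕ → ℂ) (a : ℕ) (l : List ℕ) (x : ℝ) :
    charProd b ζ (a :: l) x = stepChar (ζ a) (cell b a) x * charProd b ζ l x := rfl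

theorem measurable_charProd (b : ℕ) (ζ : ℕ → ℂ) (l : List ℕ) : Measurable (charProd b ζ l) := by
  induction l with
  | nil => exact measurable_const
  | cons a l ih => exact (measurable_stepChar _ _).mul ih

theorem norm_charProd (hζ : ∀ a ∈ l, ‖ζ a‖ = 1) (x : ℝ) : ‖charProd b ζ l x‖ = 1 := by
  induction l with
  | nil => exact norm_one
  | cons a l ih =>
    rw [List.forall_mem_cons] at hζ
    rw [charProd_cons, norm_mul, norm_stepChar hζ.1, ih hζ.2, one_mul]

variable [NeZero b] {a : ℕ}

theorem cellConst_charProd (hl : ∀ a' ∈ l, a' < a) :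
    CellConst (b * cell b a) (charProd b ζ l) := by
  intro x y hxy
  rw [charProd, charProd, List.map_congr_left fun a' ha' => ?_]
  obtain ⟨n, hn⟩ := exists_cell_eq (b := b) (hl a' ha')
  refine CellConst.of_natCast_mul n ?_ hxy
  rw [← hn]
  exact cellConst_stepChar (ζ a') (cell b a')

variable {z μ : ℂ} {W : ℝ → ℂ}

/-- Only the finest character is integrated: its product with `W` has mean zero on the cells on
which the other characters are constant. -/
theorem IsLevel.prim_mul_charProd_cons {a' : ℕ} (hW : IsLevel b a z μ W) (h : a' < a)
    (ha' : 1 ≤ a') (hl : ∀ c ∈ l, c < a') (hζ : ∀ c ∈ a' :: l, IsNontrivialRoot b (ζ c)) :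
    prim (W * charProd b ζ (a' :: l)) = stepPrim (ζ a') (cell b a') W * charProd b ζ l := by
  rw [List.forall_mem_cons] at hζ
  set F := fun x => stepChar (ζ a') (cell b a') x * W x
  have hFi := hW.intervalIntegrable_stepChar_mul hζ.1 (cell b a')
  have hF0 (n : ℕ) (s : ℝ) : ∫ x in s..(s + n * (b * cell b a')), F x = 0 :=
    (hW.quasiPeriodic_stepChar_mul h hζ.1).integral_period_eq_zero hζ.1.ne_one hζ.1.pow_eq_one n s
  have hint (x : ℝ) :
      ∫ t in (0 : ℝ)..x, charProd b ζ l t * F t = charProd b ζ l x * ∫ t in (0 : ℝ)..x, F t := by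
    refine integral_cellConst_mul (mul_pos (mod_cast NeZero.pos b) (cell_pos a')) hFi
      (fun s t => intervalIntegrable_bdd_mul (hFi s t) (measurable_charProd b ζ l)
        fun x => (norm_charProd (fun c hc => (hζ.2 c hc).norm_eq_one) x).le)
      (cellConst_charProd hl) (fun n => ?_) x
    simpa using hF0 1 (n * (b * cell b a'))
  have hmean : ∫ x in (0 : ℝ)..1, F x = 0 := by
    obtain ⟨n, hn⟩ := exists_cell_eq (b := b) ha'
    rw [cell_zero] at hn
    simpa [← hn] using hF0 n 0
  have hK : W * charProd b ζ (a' :: l) = fun x => charProd b ζ l x * F x := by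
    ext x
    simp only [F, Pi.mul_apply, charProd_cons]
    ring
  ext x
  simp only [prim, hK, hint, hmean, mul_zero, sub_zero]
  exact mul_comm _ _

theorem IsLevel.prim_iterate_mul_charProd_append {l₁ l₂ : List ℕ} (hW : IsLevel b a z μ W)
    (hl : (a :: (l₁ ++ l₂)).Pairwise (· > ·)) (hpos : ∀ c ∈ l₁, 1 ≤ c)
    (hζ : ∀ c ∈ l₁ ++ l₂, IsNontrivialRoot b (ζ c)) :
    prim^[l₁.length] (W * charProd b ζ (l₁ ++ l₂)) =
      nestedPrim b ζ l₁ W * charProd b ζ l₂ := by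
  induction l₁ generalizing a z μ W with
  | nil => rfl
  | cons a' l₁ ih =>
    rw [List.cons_append] at hl hζ ⊢
    obtain ⟨hal, hl⟩ := List.pairwise_cons.1 hl
    have ha' := hal a' (by simp)
    rw [List.forall_mem_cons] at hpos
    rw [List.length_cons, Function.iterate_succ_apply,
      hW.prim_mul_charProd_cons ha' hpos.1 (List.pairwise_cons.1 hl).1 hζ]
    exact ih (hW.isLevel_stepPrim ha' (hζ a' (by simp))) hl hpos.2 fun c hc => hζ c (by simp [hc])

theorem IsLevel.prim_iterate_mul_charProd (hW : IsLevel b a z μ W)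
    (hl : (a :: l).Pairwise (· > ·)) (hpos : ∀ c ∈ l, 1 ≤ c)
    (hζ : ∀ c ∈ l, IsNontrivialRoot b (ζ c)) (n : ℕ) :
    prim^[n] (W * charProd b ζ l) =
      prim^[n - l.length] (nestedPrim b ζ (l.take n) W) * charProd b ζ (l.drop n) := by
  obtain hn | hn := le_total n l.length
  · have h := hW.prim_iterate_mul_charProd_append (l₁ := l.take n) (l₂ := l.drop n) (ζ := ζ)
      (by rwa [List.take_append_drop]) (fun c hc => hpos c (List.mem_of_mem_take hc))
      (by rwa [List.take_append_drop])
    rw [List.take_append_drop, List.length_take_of_le hn] at h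
    rw [h, Nat.sub_eq_zero_of_le hn, Function.iterate_zero_apply]
  · have h := hW.prim_iterate_mul_charProd_append (l₁ := l) (l₂ := []) (ζ := ζ)
      (by rwa [List.append_nil]) hpos (by rwa [List.append_nil])
    rw [List.append_nil, charProd_nil, mul_one] at h
    rw [List.take_of_length_le hn, List.drop_of_length_le hn, charProd_nil, mul_one, ← h,
      ← Function.iterate_add_apply, Nat.sub_add_cancel hn]

end CharProd

section BoundedRoots

/-- `z ≠ 1` is a `b`-th root of unity, `|1 - z| ≥ m`, and `|1 - zⁿ| ≤ M` for all `n`. -/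
structure IsBoundedRoot (b : ℕ) (m M : ℝ) (z : ℂ) : Prop extends IsNontrivialRoot b z where
  le_norm_one_sub : m ≤ ‖1 - z‖
  norm_one_sub_zpow_le : ∀ n : ℤ, ‖1 - z ^ n‖ ≤ M

namespace IsBoundedRoot

variable {b : ℕ} {m M : ℝ} {z : ℂ}

theorem nonneg (hz : IsBoundedRoot b m M z) : 0 ≤ M :=
  (norm_nonneg _).trans (hz.norm_one_sub_zpow_le 0)

theorem norm_inv_one_sub_le (hz : IsBoundedRoot b m M z) (hm : 0 < m) :
    ‖(1 - z)⁻¹‖ ≤ m⁻¹ := by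
  rw [norm_inv]
  exact inv_anti₀ hm hz.le_norm_one_sub

variable [NeZero b]

theorem one_le (hz : IsBoundedRoot b m M z) : 1 ≤ M := by
  have hb : (0 : ℝ) < b := mod_cast NeZero.pos b
  have hsum : (b : ℝ) ≤ ∑ j ∈ Finset.range b, ‖1 - z ^ j‖ := by
    rw [← Complex.norm_natCast, ← hz.sum_one_sub_pow]
    exact norm_sum_le _ _
  have hsum_le : ∑ j ∈ Finset.range b, ‖1 - z ^ j‖ ≤ b * M := by
    simpa using Finset.sum_le_card_nsmul (Finset.range b) _ M fun j _ =>
      mod_cast hz.norm_one_sub_zpow_le j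
  nlinarith

theorem norm_stepPrim_one_le (hz : IsBoundedRoot b m M z) (hm : 0 < m) (a : ℕ) (x : ℝ) :
    ‖stepPrim z (cell b a) 1 x‖ ≤ M / m * cell b a := by
  have hone := isLevel_one (a + 1) hz.toIsNontrivialRoot
  have h := (hone.quasiPeriodic_stepChar_mul a.lt_succ_self
    hz.toIsNontrivialRoot).norm_integral_le
    (hone.intervalIntegrable_stepChar_mul hz.toIsNontrivialRoot _) hz.ne_one hz.ne_zero (cell_pos a)
    hm hz.le_norm_one_sub hz.norm_one_sub_zpow_le
    (fun x => (by simp [norm_stepChar hz.norm_eq_one] : _ ≤ (1 : ℝ))) x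
  rwa [mul_one] at h

theorem norm_stepPrim_one_sub_le (hz : IsBoundedRoot b m M z) (hm : 0 < m) (a : ℕ) (x : ℝ) :
    ‖stepPrim z (cell b a) 1 x - (1 - z)⁻¹ * cell b a‖ ≤ cell b a / m := by
  have hone := isLevel_one (a + 1) hz.toIsNontrivialRoot
  have h := (hone.quasiPeriodic_stepChar_mul a.lt_succ_self
    hz.toIsNontrivialRoot).norm_integral_sub_primCenter_le
    (hone.intervalIntegrable_stepChar_mul hz.toIsNontrivialRoot _) hz.ne_one (cell_pos a).le
    hm hz.le_norm_one_sub (fun x => (by simp [norm_stepChar hz.norm_eq_one] : _ ≤ (1 : ℝ))) x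
  rwa [hone.primCenter_stepChar_mul a.lt_succ_self, mul_one, mul_one] at h

end IsBoundedRoot

end BoundedRoots

section Bounds

variable {b : ℕ} [NeZero b] {a a' : ℕ} {m M : ℝ} {z z' μ : ℂ} {W : ℝ → ℂ}

namespace IsLevel

theorem norm_integral_sub_le (hW : IsLevel b a z μ W) (hz : IsBoundedRoot b m M z) (hm : 0 < m)
    {B : ℝ} (hB : ∀ x, ‖W x - μ‖ ≤ B) (x : ℝ) :
    ‖∫ t in (0 : ℝ)..x, (W t - μ)‖ ≤ M / m * (cell b a * B) :=
  hW.quasiPeriodic.norm_integral_le hW.intervalIntegrable_sub hz.ne_one hz.ne_zero (cell_pos a) hm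
    hz.le_norm_one_sub hz.norm_one_sub_zpow_le hB x

theorem norm_iterate_prim_le (hW : IsLevel b a z μ W) (hz : IsBoundedRoot b m M z) (hm : 0 < m)
    (ha : 1 ≤ a) {B C : ℝ} (hB : ∀ x, ‖W x - μ‖ ≤ B) (hC : ∀ x, ‖W x‖ ≤ C) (hBC : M * B ≤ C)
    (n : ℕ) (x : ℝ) : ‖prim^[n] W x‖ ≤ C * (cell b a / m) ^ n := by
  have hL := cell_pos (b := b) a
  induction n generalizing μ W B C with
  | zero => simpa using hC x
  | succ n ih =>
    have hprim (x : ℝ) : ‖prim W x‖ ≤ C * (cell b a / m) := by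
      rw [hW.prim_apply ha]
      calc _ ≤ M / m * (cell b a * B) := hW.norm_integral_sub_le hz hm hB x
        _ = M * B * (cell b a / m) := by ring
        _ ≤ C * (cell b a / m) := by gcongr
    have hcenter (x : ℝ) :
        ‖prim W x - primCenter (cell b a) z fun x => W x - μ‖ ≤ cell b a * B / m := by
      rw [hW.prim_apply ha]
      exact hW.quasiPeriodic.norm_integral_sub_primCenter_le hW.intervalIntegrable_sub hz.ne_one
        hL.le hm hz.le_norm_one_sub hB x
    rw [Function.iterate_succ_apply, pow_succ', ← mul_assoc]
    refine ih (hW.isLevel_prim ha) hcenter hprim ?_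
    calc _ = M * B * (cell b a / m) := by ring
      _ ≤ C * (cell b a / m) := by gcongr

theorem stepPrim_eq (hW : IsLevel b a z μ W) (h : a' < a) (hz' : IsNontrivialRoot b z') (x : ℝ) :
    stepPrim z' (cell b a') W x = μ * stepPrim z' (cell b a') 1 x +
      stepChar z' (cell b a') x * ∫ t in (0 : ℝ)..x, (W t - μ) := by
  have hi (s t : ℝ) := Walsh.intervalIntegrable_stepChar_mul hz'.norm_eq_one (cell b a')
    (hW.intervalIntegrable_sub s t)
  have hone := (isLevel_one a hz').intervalIntegrable_stepChar_mul hz' (cell b a')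
  rw [← integral_cellConst_mul (cell_pos a') hW.intervalIntegrable_sub hi
    (cellConst_stepChar z' _) (fun n => hW.integral_sub_eq_zero h _), stepPrim, stepPrim,
    ← intervalIntegral.integral_const_mul,
    ← intervalIntegral.integral_add ((hone 0 x).const_mul μ) (hi 0 x)]
  congr! 2 with t
  simp only [Pi.one_apply]
  ring

end IsLevel

/-- The bounds that propagate along nested primitives: `A` is the size of the mean `μ` of `W`,
and `i` is the number of integrations that led to `W`. -/
structure IsControlled (b a : ℕ) (m M : ℝ) (z μ : ℂ) (i : ℕ) (A : ℝ) (W : ℝ → ℂ) : Prop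
    extends IsLevel b a z μ W, IsBoundedRoot b m M z where
  norm_mean_le : ‖μ‖ ≤ A
  norm_sub_mean_le : ∀ x, ‖W x - μ‖ ≤ A * ∑ j ∈ Finset.range i, (M / b) ^ j
  norm_le : ∀ x, ‖W x‖ ≤ A * (M * (1 + m * ∑ j ∈ Finset.range i, (M / b) ^ j))

namespace IsControlled

variable {i : ℕ} {A : ℝ}

theorem norm_integral_sub_le (hW : IsControlled b a m M z μ i A W) (hm : 0 < m) (h : a' < a)
    (x : ℝ) : ‖∫ t in (0 : ℝ)..x, (W t - μ)‖ ≤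
      A * cell b a' / m * (M / b * ∑ j ∈ Finset.range i, (M / b) ^ j) := by
  have hb : (0 : ℝ) < b := mod_cast NeZero.pos b
  have hAG := (norm_nonneg _).trans (hW.norm_sub_mean_le 0)
  have hM := hW.nonneg
  have hcell : cell b a ≤ cell b a' / b := by
    rw [le_div_iff₀' hb]
    exact mul_cell_le h
  refine (hW.toIsLevel.norm_integral_sub_le hW.toIsBoundedRoot hm hW.norm_sub_mean_le x).trans ?_
  calc _ ≤ M / m * (cell b a' / b * (A * ∑ j ∈ Finset.range i, (M / b) ^ j)) := by gcongr
    _ = _ := by ring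

theorem norm_stepPrim_sub_mul_le (hW : IsControlled b a m M z μ i A W) (hm : 0 < m) (h : a' < a)
    (hz' : IsNontrivialRoot b z') {c : ℂ} {B x : ℝ} (hB : ‖stepPrim z' (cell b a') 1 x - c‖ ≤ B) :
    ‖stepPrim z' (cell b a') W x - μ * c‖ ≤
      A * B + A * cell b a' / m * (M / b * ∑ j ∈ Finset.range i, (M / b) ^ j) := by
  rw [hW.stepPrim_eq h hz', add_sub_right_comm, ← mul_sub]
  refine norm_add_le_of_le (norm_mul_le_of_le hW.norm_mean_le hB) ?_
  rw [norm_mul, norm_stepChar hz'.norm_eq_one, one_mul]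
  exact hW.norm_integral_sub_le hm h x

theorem isControlled_stepPrim (hW : IsControlled b a m M z μ i A W) (hbm : 1 ≤ b * m)
    (h : a' < a) (hz' : IsBoundedRoot b m M z') :
    IsControlled b a' m M z' ((1 - z')⁻¹ * (cell b a' * μ)) (i + 1) (A * cell b a' / m)
      (stepPrim z' (cell b a') W) := by
  have hb : (0 : ℝ) < b := mod_cast NeZero.pos b
  have hm : 0 < m := pos_of_mul_pos_right (by linarith) hb.le
  have hM := hz'.nonneg
  have hL := cell_pos (b := b) a'
  have hA := (norm_nonneg _).trans hW.norm_mean_le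
  have : 0 ≤ ∑ j ∈ Finset.range i, (M / b) ^ j := Finset.sum_nonneg fun _ _ => by positivity
  refine ⟨hW.isLevel_stepPrim h hz'.toIsNontrivialRoot, hz'.le_norm_one_sub,
    hz'.norm_one_sub_zpow_le, ?_, fun x => ?_, fun x => ?_⟩
  · rw [norm_mul, norm_mul, Complex.norm_real, Real.norm_of_nonneg hL.le]
    calc _ ≤ m⁻¹ * (cell b a' * A) := by
          gcongr
          exacts [hz'.norm_inv_one_sub_le hm, hW.norm_mean_le]
      _ = A * cell b a' / m := by ring
  · have hbound := hW.norm_stepPrim_sub_mul_le hm h hz'.toIsNontrivialRoot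
      (hz'.norm_stepPrim_one_sub_le hm a' x)
    calc _ = ‖stepPrim z' (cell b a') W x - μ * ((1 - z')⁻¹ * cell b a')‖ := by congr 1; ring
      _ ≤ _ := hbound
      _ = _ := by rw [geom_sum_succ]; ring
  · have hbound := hW.norm_stepPrim_sub_mul_le hm h hz'.toIsNontrivialRoot (c := 0)
      (by simpa only [sub_zero] using hz'.norm_stepPrim_one_le hm a' x)
    rw [mul_zero, sub_zero] at hbound
    calc _ ≤ _ := hbound
      _ = A * cell b a' / m * (M * (1 + 1 / b * ∑ j ∈ Finset.range i, (M / b) ^ j)) := by ring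
      _ ≤ _ := by
        gcongr
        · rwa [div_le_iff₀' hb]
        · exact i.le_succ

theorem isControlled_nestedPrim {ζ : ℕ → ℂ} {l : List ℕ} (hW : IsControlled b a m M z μ i A W)
    (hbm : 1 ≤ b * m) (hl : (a :: l).Pairwise (· > ·))
    (hζ : ∀ c ∈ l, IsBoundedRoot b m M (ζ c)) :
    ∃ z μ, IsControlled b (l.getLastD a) m M z μ (i + l.length)
      (A * cell b l.sum / m ^ l.length) (nestedPrim b ζ l W) := by
  induction l generalizing a z μ i A W with
  | nil => exact ⟨z, μ, by simpa [cell_zero, nestedPrim] using hW⟩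
  | cons a' l ih =>
    obtain ⟨hal, hl⟩ := List.pairwise_cons.1 hl
    rw [List.forall_mem_cons] at hζ
    have hsize : A * cell b (a' :: l).sum / m ^ (a' :: l).length =
        A * cell b a' / m * cell b l.sum / m ^ l.length := by
      rw [List.sum_cons, cell_add, List.length_cons, pow_succ']
      ring
    rw [List.getLastD_cons, hsize, List.length_cons, add_comm l.length,
      ← add_assoc]
    exact ih (hW.isControlled_stepPrim hbm (hal a' (by simp)) hζ.1) hl hζ.2

theorem norm_iterate_prim_le (hW : IsControlled b a m M z μ i A W) (hm : 0 < m) (ha : 1 ≤ a)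
    (hG : ∑ j ∈ Finset.range i, (M / b) ^ j ≤ 1 + m * ∑ j ∈ Finset.range i, (M / b) ^ j)
    (n : ℕ) (x : ℝ) : ‖prim^[n] W x‖ ≤
      A * (M * (1 + m * ∑ j ∈ Finset.range i, (M / b) ^ j)) * (cell b a / m) ^ n := by
  have hA := (norm_nonneg _).trans hW.norm_mean_le
  have hM := hW.nonneg
  refine hW.toIsLevel.norm_iterate_prim_le hW.toIsBoundedRoot hm ha hW.norm_sub_mean_le hW.norm_le
    ?_ n x
  rw [mul_left_comm]
  gcongr

end IsControlled

end Bounds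

section CharProdBounds

theorem geom_sum_le_one_add_mul {b : ℕ} (hb : 2 ≤ b) {m M : ℝ} (hbm : 2 ≤ b * m) (hM0 : 0 ≤ M)
    (hM : M ≤ 2) (n : ℕ) :
    ∑ j ∈ Finset.range n, (M / b) ^ j ≤ 1 + m * ∑ j ∈ Finset.range n, (M / b) ^ j := by
  have hb : (2 : ℝ) ≤ b := mod_cast hb
  have hG (n : ℕ) : 0 ≤ ∑ j ∈ Finset.range n, (M / b) ^ j :=
    Finset.sum_nonneg fun _ _ => by positivity
  have hbound : (b - 2) * ∑ j ∈ Finset.range n, (M / b) ^ j ≤ b := by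
    induction n with
    | zero => simp
    | succ n ih =>
      have hstep : M / b * ((b - 2) * ∑ j ∈ Finset.range n, (M / b) ^ j) ≤ 2 / b * b := by
        have := mul_nonneg (sub_nonneg.2 hb) (hG n)
        gcongr
      rw [div_mul_cancel₀ _ (by positivity)] at hstep
      rw [geom_sum_succ]
      linarith
  have hcompare := mul_le_mul_of_nonneg_right hbm (hG n)
  have hscaled : b * ∑ j ∈ Finset.range n, (M / b) ^ j ≤
      b * (1 + m * ∑ j ∈ Finset.range n, (M / b) ^ j) := by linarith
  exact le_of_mul_le_mul_left hscaled (by linarith)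

/-- The sum of the first `n` terms of the list `l`, repeating its last term if `l` is too short
(or `a` if `l` is empty): the exponent `μ_{n,per}` when `l` lists the positions of the nonzero
digits. -/
def sumTake (n : ℕ) (l : List ℕ) (a : ℕ) : ℕ :=
  (l.take n).sum + (n - l.length) * (l.take n).getLastD a

theorem cell_sum_take_mul_pow (b : ℕ) (m : ℝ) (n : ℕ) (l : List ℕ) (a : ℕ) :
    cell b (l.take n).sum / m ^ (l.take n).length *
      (cell b ((l.take n).getLastD a) / m) ^ (n - l.length) = cell b (sumTake n l a) / m ^ n := by
  have hn : n = (l.take n).length + (n - l.length) := by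
    rw [List.length_take]
    omega
  have hcell (c d : ℕ) : cell b (c * d) = cell b d ^ c := by
    rw [cell, cell, mul_comm, pow_mul, inv_pow]
  rw [sumTake, cell_add, hcell, div_pow, div_mul_div_comm, ← pow_add, ← hn]

variable {b : ℕ} [NeZero b] {ζ : ℕ → ℂ} {l : List ℕ} {a : ℕ}

theorem norm_iterate_prim_charProd {z : ℂ} (hz : IsNontrivialRoot b z)
    (hl : (a :: l).Pairwise (· > ·)) (hpos : ∀ c ∈ l, 1 ≤ c)
    (hζ : ∀ c ∈ l, IsNontrivialRoot b (ζ c)) (n : ℕ) (x : ℝ) :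
    ‖prim^[n] (charProd b ζ l) x‖ =
      ‖prim^[n - l.length] (nestedPrim b ζ (l.take n) 1) x‖ := by
  rw [← one_mul (charProd b ζ l), (isLevel_one a hz).prim_iterate_mul_charProd hl hpos hζ,
    Pi.mul_apply, norm_mul, norm_charProd, mul_one]
  exact fun c hc => (hζ c (List.mem_of_mem_drop hc)).norm_eq_one

theorem norm_iterate_prim_charProd_le {m M : ℝ} {z : ℂ} (hz : IsBoundedRoot b m M z)
    (hbm : 2 ≤ b * m) (hM : M ≤ 2)
    (hl : (a :: l).Pairwise (· > ·)) (hpos : ∀ c ∈ a :: l, 1 ≤ c)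
    (hζ : ∀ c ∈ l, IsBoundedRoot b m M (ζ c)) (n : ℕ) (x : ℝ) :
    ‖prim^[n] (charProd b ζ l) x‖ ≤ cell b (sumTake n l a) / m ^ n *
      (M * (1 + m * ∑ j ∈ Finset.range l.length, (M / b) ^ j)) := by
  have hm : 0 < m := pos_of_mul_pos_right (by linarith) (Nat.cast_nonneg b)
  have hone : IsControlled b a m M z 1 0 1 1 :=
    ⟨isLevel_one a hz.toIsNontrivialRoot, hz.le_norm_one_sub, hz.norm_one_sub_zpow_le, by simp,
      by simp, by simpa using hz.one_le⟩
  have htake : (a :: l.take n).Pairwise (· > ·) :=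
    hl.sublist ((List.take_sublist n l).cons_cons a)
  obtain ⟨z', μ', hnested⟩ := hone.isControlled_nestedPrim (by linarith) htake
    fun c hc => hζ c (List.mem_of_mem_take hc)
  have hlast : 1 ≤ (l.take n).getLastD a :=
    hpos _ (((List.take_sublist n l).cons_cons a).subset List.getLastD_mem_cons)
  rw [norm_iterate_prim_charProd hz.toIsNontrivialRoot hl
    (fun c hc => hpos c (List.mem_cons_of_mem a hc)) fun c hc => (hζ c hc).toIsNontrivialRoot]
  refine (hnested.norm_iterate_prim_le hm hlast
    (geom_sum_le_one_add_mul hz.two_le hbm hz.nonneg hM _) _ x).trans ?_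
  rw [one_mul, mul_right_comm, cell_sum_take_mul_pow, zero_add]
  have := (cell_pos (b := b) (sumTake n l a)).le
  have := hz.nonneg
  gcongr
  exact List.length_take_le' n l

end CharProdBounds

section Binary

/-- In base `2`, nested primitives of `1` are real-valued with values in `[0, 2 A]`, where `A` is
their mean. -/
structure IsBinaryLevel (a : ℕ) (A : ℝ) (W : ℝ → ℂ) : Prop extends IsLevel 2 a (-1) A W where
  exists_ofReal_eq : ∀ x, ∃ r ∈ Icc 0 (2 * A), (r : ℂ) = W x

theorem isBoundedRoot_neg_one : IsBoundedRoot 2 2 2 (-1) where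
  pow_eq_one := by norm_num
  ne_one := by norm_num
  le_norm_one_sub := by norm_num
  norm_one_sub_zpow_le n := (norm_sub_le _ _).trans (by norm_num [norm_zpow])

variable {a a' : ℕ} {A : ℝ} {W : ℝ → ℂ}

theorem isBinaryLevel_one (a : ℕ) : IsBinaryLevel a 1 1 where
  toIsLevel := by simpa using isLevel_one a isBoundedRoot_neg_one.toIsNontrivialRoot
  exists_ofReal_eq _ := ⟨1, by norm_num, by simp⟩

namespace IsBinaryLevel

theorem norm_sub_mean_le (hW : IsBinaryLevel a A W) (x : ℝ) : ‖W x - A‖ ≤ A := by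
  obtain ⟨r, hr, hrW⟩ := hW.exists_ofReal_eq x
  rw [← hrW, ← Complex.ofReal_sub, Complex.norm_real, Real.norm_eq_abs, abs_le]
  exact ⟨by linarith [hr.1], by linarith [hr.2]⟩

theorem norm_le (hW : IsBinaryLevel a A W) (x : ℝ) : ‖W x‖ ≤ 2 * A := by
  obtain ⟨r, hr, hrW⟩ := hW.exists_ofReal_eq x
  rw [← hrW, Complex.norm_real, Real.norm_of_nonneg hr.1]
  exact hr.2

theorem exists_ofReal_eq_integral (hW : IsBinaryLevel a A W) (h : a' < a) {y : ℝ}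
    (hy : y ∈ Icc 0 (cell 2 a')) :
    ∃ r ∈ Icc 0 (cell 2 a' * A), (r : ℂ) = ∫ t in (0 : ℝ)..y, W t := by
  choose w hw hwW using hW.exists_ofReal_eq
  have hwint (s t : ℝ) : IntervalIntegrable w volume s t := by
    have hwre : w = fun x => (W x).re := funext fun x => by rw [← hwW, Complex.ofReal_re]
    rw [hwre]
    exact (Complex.continuous_re.comp hW.continuous).intervalIntegrable s t
  have hcell := hW.integral_cell h
  simp only [← hwW, intervalIntegral.integral_ofReal] at hcell ⊢
  refine ⟨_, ⟨intervalIntegral.integral_nonneg hy.1 fun t _ => (hw t).1, ?_⟩, rfl⟩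
  calc _ ≤ ∫ t in (0 : ℝ)..cell 2 a', w t :=
        intervalIntegral.integral_mono_interval le_rfl hy.1 hy.2
          (.of_forall fun t => (hw t).1) (hwint _ _)
    _ = cell 2 a' * A := mod_cast hcell

/-- Multiplication by `-1` is the reflection of `[-A, A]`: it is enough to look at one cell. -/
theorem isBinaryLevel_stepPrim (hW : IsBinaryLevel a A W) (h : a' < a) :
    IsBinaryLevel a' (A * cell 2 a' / 2) (stepPrim (-1) (cell 2 a') W) := by
  have hL := cell_pos (b := 2) a'
  have hlevel : IsLevel 2 a' (-1) ↑(A * cell 2 a' / 2) (stepPrim (-1) (cell 2 a') W) := by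
    convert hW.isLevel_stepPrim h isBoundedRoot_neg_one.toIsNontrivialRoot using 1
    push_cast
    ring
  refine ⟨hlevel, fun x => ?_⟩
  obtain ⟨hx0, hx1⟩ := (floor_div_eq_iff hL (x := x)).1 rfl
  obtain ⟨y, hy⟩ : ∃ y, x = y + ⌊x / cell 2 a'⌋ * cell 2 a' :=
    ⟨x - ⌊x / cell 2 a'⌋ * cell 2 a', by ring⟩
  have hy_mem : y ∈ Icc 0 (cell 2 a') := ⟨by linarith, by linarith⟩
  obtain ⟨r, hr, hrW⟩ := hW.exists_ofReal_eq_integral h hy_mem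
  have hshift := hlevel.quasiPeriodic.map_add_intCast_mul (by norm_num) ⌊x / cell 2 a'⌋ y
  rw [← hy, stepPrim_eq_integral _ _ hy_mem, ← hrW, sub_eq_iff_eq_add] at hshift
  rw [hshift]
  obtain hsign | hsign := Int.even_or_odd ⌊x / cell 2 a'⌋
  · exact ⟨r, ⟨hr.1, by linarith [hr.2]⟩, by rw [hsign.neg_one_zpow]; ring⟩
  · refine ⟨A * cell 2 a' - r, ⟨by linarith [hr.2], by linarith [hr.1]⟩, ?_⟩
    rw [hsign.neg_one_zpow]
    push_cast
    ring

theorem isBinaryLevel_nestedPrim {ζ : ℕ → ℂ} {l : List ℕ} (hW : IsBinaryLevel a A W)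
    (hl : (a :: l).Pairwise (· > ·)) (hζ : ∀ c ∈ l, ζ c = -1) :
    IsBinaryLevel (l.getLastD a) (A * cell 2 l.sum / 2 ^ l.length) (nestedPrim 2 ζ l W) := by
  induction l generalizing a A W with
  | nil => simpa [cell_zero, nestedPrim] using hW
  | cons a' l ih =>
    obtain ⟨hal, hl⟩ := List.pairwise_cons.1 hl
    rw [List.forall_mem_cons] at hζ
    have hsize : A * cell 2 (a' :: l).sum / 2 ^ (a' :: l).length =
        A * cell 2 a' / 2 * cell 2 l.sum / 2 ^ l.length := by
      rw [List.sum_cons, cell_add, List.length_cons, pow_succ']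
      ring
    rw [List.getLastD_cons, hsize, nestedPrim, hζ.1]
    exact ih (hW.isBinaryLevel_stepPrim (hal a' (by simp))) hl hζ.2

end IsBinaryLevel

theorem norm_iterate_prim_charProd_two_le {ζ : ℕ → ℂ} {l : List ℕ}
    (hl : (a :: l).Pairwise (· > ·)) (hpos : ∀ c ∈ a :: l, 1 ≤ c) (hζ : ∀ c ∈ l, ζ c = -1)
    (n : ℕ) (x : ℝ) :
    ‖prim^[n] (charProd 2 ζ l) x‖ ≤ cell 2 (sumTake n l a) / 2 ^ n * 2 := by
  have hroot := isBoundedRoot_neg_one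
  have htake : (a :: l.take n).Pairwise (· > ·) :=
    hl.sublist ((List.take_sublist n l).cons_cons a)
  have hnested := (isBinaryLevel_one a).isBinaryLevel_nestedPrim htake
    fun c hc => hζ c (List.mem_of_mem_take hc)
  have hlast : 1 ≤ (l.take n).getLastD a :=
    hpos _ (((List.take_sublist n l).cons_cons a).subset List.getLastD_mem_cons)
  rw [norm_iterate_prim_charProd hroot.toIsNontrivialRoot hl
    (fun c hc => hpos c (List.mem_cons_of_mem a hc))
    fun c hc => hζ c hc ▸ hroot.toIsNontrivialRoot, ← cell_sum_take_mul_pow]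
  refine (hnested.norm_iterate_prim_le hroot two_pos hlast hnested.norm_sub_mean_le
    hnested.norm_le le_rfl _ x).trans_eq ?_
  ring

end Binary

section IntegrationByParts

theorem der_succ_of_mem_Ioo (i : ℕ) (f : ℝ → ℝ) {x : ℝ} (hx : x ∈ Ioo 0 1) :
    der (i + 1) f x = deriv (der i f) x := by
  rw [der, iteratedDerivWithin_succ]
  exact derivWithin_of_mem_nhds (Icc_mem_nhds hx.1 hx.2)

theorem intervalIntegrable_der_succ {f : ℝ → ℝ} {i : ℕ}
    (hf : AbsolutelyContinuousOnInterval (der i f) 0 1) :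
    IntervalIntegrable (der (i + 1) f) volume 0 1 := by
  have hderiv := hf.intervalIntegrable_deriv
  rw [intervalIntegrable_iff_integrableOn_Ioo_of_le zero_le_one] at hderiv ⊢
  exact hderiv.congr_fun (fun x hx => (der_succ_of_mem_Ioo i f hx).symm) measurableSet_Ioo

theorem integral_mul_eq_neg_integral_deriv_mul {f g : ℝ → ℝ} {a b : ℝ}
    (hf : AbsolutelyContinuousOnInterval f a b) (hg : IntervalIntegrable g volume a b)
    (hg0 : ∫ x in a..b, g x = 0) :
    ∫ x in a..b, f x * g x = -∫ x in a..b, deriv f x * ∫ t in a..x, g t := by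
  have hG := hg.absolutelyContinuousOnInterval_intervalIntegral left_mem_uIcc
  have hderiv : ∀ᵐ x, x ∈ uIoc a b → f x * deriv (fun x => ∫ t in a..x, g t) x = f x * g x := by
    filter_upwards [hg.ae_hasDerivAt_integral] with x hx hxab
    rw [(hx (uIoc_subset_uIcc hxab) a left_mem_uIcc).deriv]
  rw [← intervalIntegral.integral_congr_ae hderiv, hf.integral_mul_deriv_eq_deriv_mul hG, hg0]
  simp

variable {E : Type*} [NormedAddCommGroup E] [NormedSpace ℝ E]

theorem intervalIntegrable_iterate_prim {K : ℝ → E} (hK : IntervalIntegrable K volume 0 1)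
    (n : ℕ) : IntervalIntegrable (prim^[n] K) volume 0 1 := by
  induction n with
  | zero => exact hK
  | succ n ih =>
    rw [Function.iterate_succ_apply']
    exact (intervalIntegral.continuousOn_primitive_interval' (ih.sub intervalIntegrable_const)
      left_mem_uIcc).intervalIntegrable

variable [CompleteSpace E]

theorem integral_smul_eq_neg_integral_deriv_smul {f : ℝ → ℝ} {K : ℝ → E} {a b : ℝ}
    (hf : AbsolutelyContinuousOnInterval f a b) (hK : IntervalIntegrable K volume a b)
    (hK0 : ∫ x in a..b, K x = 0) :
    ∫ x in a..b, f x • K x = -∫ x in a..b, deriv f x • ∫ t in a..x, K t := by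
  have hprim : ContinuousOn (fun x => ∫ t in a..x, K t) (uIcc a b) :=
    intervalIntegral.continuousOn_primitive_interval' hK left_mem_uIcc
  refine (SeparatingDual.eq_iff_forall_dual_eq (R := ℝ)).2 fun φ => ?_
  have hφprim : ∀ x ∈ uIcc a b, φ (∫ t in a..x, K t) = ∫ t in a..x, φ (K t) := fun x hx =>
    (φ.intervalIntegral_comp_comm (hK.mono_set (uIcc_subset_uIcc_left hx))).symm
  have h := integral_mul_eq_neg_integral_deriv_mul hf
    (g := fun x => φ (K x)) ⟨φ.integrable_comp hK.1, φ.integrable_comp hK.2⟩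
    (by rw [φ.intervalIntegral_comp_comm hK, hK0, map_zero])
  rw [map_neg, ← φ.intervalIntegral_comp_comm (hK.continuousOn_smul hf.continuousOn),
    ← φ.intervalIntegral_comp_comm (hf.intervalIntegrable_deriv.smul_continuousOn hprim)]
  simp only [map_smul, smul_eq_mul]
  rw [h, intervalIntegral.integral_congr fun x hx => congrArg (deriv f x * ·) (hφprim x hx)]

theorem integral_der_smul_eq {f : ℝ → ℝ} {i : ℕ} {K : ℝ → E}
    (hf : AbsolutelyContinuousOnInterval (der i f) 0 1) (hf0 : ∫ x in (0 : ℝ)..1, der i f x = 0)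
    (hK : IntervalIntegrable K volume 0 1) :
    ∫ x in (0 : ℝ)..1, der i f x • K x = -∫ x in (0 : ℝ)..1, der (i + 1) f x • prim K x := by
  set e := ∫ s in (0 : ℝ)..1, K s with he
  have hKe0 : ∫ x in (0 : ℝ)..1, (K x - e) = 0 := by
    rw [intervalIntegral.integral_sub hK intervalIntegrable_const, ← he]
    simp
  calc ∫ x in (0 : ℝ)..1, der i f x • K x
      = ∫ x in (0 : ℝ)..1, der i f x • (K x - e) := by
        simp_rw [smul_sub]
        rw [intervalIntegral.integral_sub (hK.continuousOn_smul hf.continuousOn)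
          (intervalIntegrable_const.continuousOn_smul hf.continuousOn),
          intervalIntegral.integral_smul_const, hf0, zero_smul, sub_zero]
    _ = -∫ x in (0 : ℝ)..1, deriv (der i f) x • prim K x :=
        integral_smul_eq_neg_integral_deriv_smul hf (hK.sub intervalIntegrable_const) hKe0
    _ = -∫ x in (0 : ℝ)..1, der (i + 1) f x • prim K x :=
        congrArg _ <| intervalIntegral.integral_congr_Ioo_of_le zero_le_one fun x hx =>
          congrArg (· • prim K x) (der_succ_of_mem_Ioo i f hx).symm

theorem norm_integral_smul_eq {f : ℝ → ℝ} {n : ℕ} {K : ℝ → E}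
    (hf : ∀ i < n, AbsolutelyContinuousOnInterval (der i f) 0 1)
    (hf0 : ∀ i < n, ∫ x in (0 : ℝ)..1, der i f x = 0) (hK : IntervalIntegrable K volume 0 1) :
    ‖∫ x in (0 : ℝ)..1, f x • K x‖ = ‖∫ x in (0 : ℝ)..1, der n f x • prim^[n] K x‖ := by
  induction n with
  | zero => simp only [der, iteratedDerivWithin_zero, Function.iterate_zero_apply]
  | succ n ih =>
    rw [ih (fun i hi => hf i (hi.trans n.lt_succ_self)) fun i hi => hf0 i (hi.trans n.lt_succ_self),
      integral_der_smul_eq (hf n n.lt_succ_self) (hf0 n n.lt_succ_self)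
        (intervalIntegrable_iterate_prim hK n), norm_neg, Function.iterate_succ_apply']

theorem norm_integral_smul_le {f : ℝ → ℝ} {n : ℕ} (hn : 1 ≤ n) {K : ℝ → E} {B : ℝ}
    (hf : ∀ i < n, AbsolutelyContinuousOnInterval (der i f) 0 1)
    (hf0 : ∀ i < n, ∫ x in (0 : ℝ)..1, der i f x = 0) (hK : IntervalIntegrable K volume 0 1)
    (hB : ∀ x, ‖prim^[n] K x‖ ≤ B) :
    ‖∫ x in (0 : ℝ)..1, f x • K x‖ ≤ (∫ x in (0 : ℝ)..1, |der n f x|) * B := by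
  have hint : IntervalIntegrable (der n f) volume 0 1 := by
    rw [← Nat.sub_add_cancel hn]
    exact intervalIntegrable_der_succ (hf _ (Nat.sub_one_lt_of_lt hn))
  rw [norm_integral_smul_eq hf hf0 hK, ← intervalIntegral.integral_mul_const]
  refine intervalIntegral.norm_integral_le_of_norm_le zero_le_one (.of_forall fun x _ => ?_)
    (hint.abs.mul_const B)
  rw [norm_smul, Real.norm_eq_abs]
  exact mul_le_mul_of_nonneg_left (hB x) (abs_nonneg _)

end IntegrationByParts

section WalshFunctions

/-- The positions `a_1 > ⋯ > a_v` of the nonzero digits of `k` in base `b`, as a list. -/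
def positionList (b k : ℕ) : List ℕ := (positions b k).sort (· ≥ ·)

/-- The root of unity attached to the position `a` in the conjugate of the `k`-th Walsh
function. -/
def digitRoot (b k a : ℕ) : ℂ := conj (omega b) ^ natDigit b k a

variable {b k : ℕ}

theorem length_positionList (b k : ℕ) : (positionList b k).length = hammingWeight b k :=
  Finset.length_sort _

theorem mem_positionList {a : ℕ} : a ∈ positionList b k ↔ a ∈ positions b k :=
  Finset.mem_sort _

theorem one_le_of_mem_positionList {a : ℕ} (ha : a ∈ positionList b k) : 1 ≤ a := by
  rw [mem_positionList, positions, Finset.mem_filter, Finset.mem_Icc] at ha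
  exact ha.1.1

theorem pairwise_cons_positionList (b k : ℕ) :
    (((b.digits k).length + 1) :: positionList b k).Pairwise (· > ·) := by
  refine List.pairwise_cons.2 ⟨fun a ha => ?_, (Finset.sortedGT_sort _).pairwise⟩
  rw [mem_positionList, positions, Finset.mem_filter, Finset.mem_Icc] at ha
  exact Nat.lt_succ_of_le ha.1.2

theorem one_le_of_mem_cons_positionList :
    ∀ a ∈ ((b.digits k).length + 1) :: positionList b k, 1 ≤ a :=
  List.forall_mem_cons.2 ⟨Nat.succ_pos _, fun _ => one_le_of_mem_positionList⟩

theorem positions_nonempty (hk : k ≠ 0) : (positions b k).Nonempty := by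
  have hlen : 0 < (b.digits k).length := List.length_pos_iff.2 (Nat.digits_ne_nil_iff_ne_zero.2 hk)
  refine ⟨(b.digits k).length, Finset.mem_filter.2 ⟨Finset.mem_Icc.2 ⟨hlen, le_rfl⟩, ?_⟩⟩
  have hlast := Nat.getLast_digit_ne_zero b hk
  rwa [List.getLast_eq_getElem, ← List.getD_eq_getElem _ 0] at hlast

theorem sum_Icc_position {n : ℕ} (hn : n ≤ hammingWeight b k) :
    ∑ i ∈ Finset.Icc 1 n, position b k i = ((positionList b k).take n).sum := by
  induction n with
  | zero => simp
  | succ n ih =>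
    rw [← length_positionList] at hn
    rw [Finset.sum_Icc_succ_top n.succ_pos, ih (by rw [← length_positionList]; omega),
      List.sum_take_succ _ _ hn, position, Nat.add_sub_cancel]
    exact congrArg _ (List.getD_eq_getElem _ 0 hn)

theorem sumTake_positionList (hk : k ≠ 0) (n a : ℕ) :
    sumTake n (positionList b k) a = muPer b n k := by
  have hlen := length_positionList b k
  rw [muPer, if_neg hk, sumTake]
  split_ifs with hn
  · have hne : positionList b k ≠ [] := by
      rw [← List.length_pos_iff, hlen]
      exact Finset.card_pos.2 (positions_nonempty hk)
    have hlast : (positionList b k).getLastD a = position b k (hammingWeight b k) := by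
      rw [List.getLastD_eq_getLast?, List.getLast?_eq_some_getLast hne, Option.getD_some,
        List.getLast_eq_getElem, ← List.getD_eq_getElem _ 0, hlen]
      rfl
    rw [sum_Icc_position le_rfl, List.take_of_length_le (hlen.trans_le hn), hlast,
      List.take_of_length_le hlen.le, hlen]
  · rw [sum_Icc_position (not_le.1 hn).le, hlen, Nat.sub_eq_zero_of_le (not_le.1 hn).le, zero_mul,
      add_zero]

theorem natDigit_mem_Icc {a : ℕ} (hb : 2 ≤ b) (ha : a ∈ positionList b k) :
    natDigit b k a ∈ Icc 1 (b - 1) := by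
  rw [mem_positionList, positions, Finset.mem_filter, Finset.mem_Icc] at ha
  have hlt : natDigit b k a < b := by
    rw [natDigit, List.getD_eq_getElem _ _ (by omega)]
    exact Nat.digits_lt_base (by omega) (List.getElem_mem _)
  exact ⟨Nat.pos_of_ne_zero ha.2, Nat.le_sub_one_of_lt hlt⟩

theorem conj_omega_two : conj (omega 2) = -1 := by
  have hpi : 2 * (Real.pi : ℂ) * Complex.I / (2 : ℕ) = Real.pi * Complex.I := by
    push_cast
    ring
  rw [omega, hpi, Complex.exp_pi_mul_I, map_neg, map_one]

theorem digitRoot_two {a : ℕ} (ha : a ∈ positionList 2 k) : digitRoot 2 k a = -1 := by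
  have hdigit := natDigit_mem_Icc le_rfl ha
  rw [digitRoot, le_antisymm hdigit.2 hdigit.1, pow_one, conj_omega_two]

variable [NeZero b]

theorem isPrimitiveRoot_conj_omega (b : ℕ) [NeZero b] : IsPrimitiveRoot (conj (omega b)) b :=
  (Complex.isPrimitiveRoot_exp b (NeZero.ne b)).map_of_injective (starRingEnd ℂ).injective

theorem norm_conj_omega_pow (b : ℕ) [NeZero b] (c : ℕ) : ‖conj (omega b) ^ c‖ = 1 := by
  rw [norm_pow, (isPrimitiveRoot_conj_omega b).norm'_eq_one (NeZero.ne b), one_pow]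

theorem conj_wal_eq_charProd {x : ℝ} (hx : 0 ≤ x) :
    conj (wal b k x) = charProd b (digitRoot b k) (positionList b k) x := by
  rw [charProd, positionList, ← List.prod_toFinset _ (Finset.sort_nodup _ _),
    Finset.sort_toFinset, wal, map_pow, ← Finset.prod_pow_eq_pow_sum]
  refine Finset.prod_congr rfl fun a _ => ?_
  have hfloor : ⌊x / cell b a⌋ = (⌊x * (b : ℝ) ^ a⌋₊ : ℤ) := by
    rw [cell, div_inv_eq_mul, Int.natCast_floor_eq_floor (by positivity)]
  rw [stepChar, hfloor, zpow_natCast, realDigit, digitRoot, pow_mul]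
  refine (pow_eq_pow_mod _ ?_).symm
  rw [← pow_mul, mul_comm, pow_mul, (isPrimitiveRoot_conj_omega b).pow_eq_one, one_pow]

theorem coeff_ofReal_eq_integral (f : ℝ → ℝ) :
    coeff b k (fun x => (f x : ℂ)) =
      ∫ x in (0 : ℝ)..1, f x • charProd b (digitRoot b k) (positionList b k) x := by
  rw [intervalIntegral.integral_of_le zero_le_one, integral_Ioc_eq_integral_Ioo,
    ← integral_Ico_eq_integral_Ioo]
  exact setIntegral_congr_fun measurableSet_Ico fun x hx => by
    simp only [conj_wal_eq_charProd hx.1, Complex.real_smul]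

theorem norm_coeff_le {n : ℕ} (hn : 1 ≤ n) {f : ℝ → ℝ} {B : ℝ}
    (hf : ∀ i < n, AbsolutelyContinuousOnInterval (der i f) 0 1)
    (hf0 : ∀ i < n, ∫ x in (0 : ℝ)..1, der i f x = 0)
    (hB : ∀ x, ‖prim^[n] (charProd b (digitRoot b k) (positionList b k)) x‖ ≤ B) :
    ‖coeff b k (fun x => (f x : ℂ))‖ ≤ (∫ x in (0 : ℝ)..1, |der n f x|) * B := by
  rw [coeff_ofReal_eq_integral]
  refine norm_integral_smul_le hn hf hf0 ?_ hB
  simpa only [mul_one] using intervalIntegrable_bdd_mul (intervalIntegrable_const (c := 1))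
    (measurable_charProd b (digitRoot b k) (positionList b k))
    fun x => (norm_charProd (fun a _ => norm_conj_omega_pow b _) x).le

end WalshFunctions

section Constants

theorem finite_norm_one_sub (b : ℕ) :
    ((fun c : ℕ => ‖1 - conj (omega b) ^ c‖) '' Icc 1 (b - 1)).Finite :=
  (finite_Icc _ _).image _

theorem nonempty_norm_one_sub {b : ℕ} (hb : 2 ≤ b) :
    ((fun c : ℕ => ‖1 - conj (omega b) ^ c‖) '' Icc 1 (b - 1)).Nonempty :=
  (nonempty_Icc.2 (Nat.le_sub_one_of_lt hb)).image _

variable {b : ℕ} [NeZero b]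

theorem norm_one_sub_conj_omega_zpow_le (hb : 2 ≤ b) (n : ℤ) :
    ‖1 - conj (omega b) ^ n‖ ≤ MConst b := by
  have hle {c : ℕ} (hc : c ∈ Icc 1 (b - 1)) : ‖1 - conj (omega b) ^ c‖ ≤ MConst b :=
    le_csSup (finite_norm_one_sub b).bddAbove (mem_image_of_mem _ hc)
  have hpow : (conj (omega b) ^ n) ^ b = 1 := by
    rw [← zpow_natCast, zpow_comm, zpow_natCast, (isPrimitiveRoot_conj_omega b).pow_eq_one,
      one_zpow]
  obtain ⟨r, hrb, hr⟩ := (isPrimitiveRoot_conj_omega b).eq_pow_of_pow_eq_one hpow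
  rw [← hr]
  obtain rfl | hr0 := r.eq_zero_or_pos
  · rw [pow_zero, sub_self, norm_zero]
    exact (norm_nonneg _).trans (hle ⟨le_rfl, Nat.le_sub_one_of_lt hb⟩)
  · exact hle ⟨hr0, Nat.le_sub_one_of_lt hrb⟩

theorem isBoundedRoot_conj_omega_pow (hb : 2 ≤ b) {c : ℕ} (hc : c ∈ Icc 1 (b - 1)) :
    IsBoundedRoot b (mConst b) (MConst b) (conj (omega b) ^ c) where
  pow_eq_one := by rw [pow_right_comm, (isPrimitiveRoot_conj_omega b).pow_eq_one, one_pow]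
  ne_one := (isPrimitiveRoot_conj_omega b).pow_ne_one_of_pos_of_lt (Nat.ne_of_gt hc.1)
    (by have := hc.2; omega)
  le_norm_one_sub := csInf_le (finite_norm_one_sub b).bddBelow (mem_image_of_mem _ hc)
  norm_one_sub_zpow_le n := by
    rw [← zpow_natCast, ← zpow_mul]
    exact norm_one_sub_conj_omega_zpow_le hb _

theorem isBoundedRoot_digitRoot (hb : 2 ≤ b) {k a : ℕ} (ha : a ∈ positionList b k) :
    IsBoundedRoot b (mConst b) (MConst b) (digitRoot b k a) :=
  isBoundedRoot_conj_omega_pow hb (natDigit_mem_Icc hb ha)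

theorem two_le_mul_mConst (hb : 2 ≤ b) : 2 ≤ b * mConst b := by
  obtain ⟨c, hc, hmin⟩ := (nonempty_norm_one_sub hb).csInf_mem (finite_norm_one_sub b)
  rw [mConst, ← hmin]
  exact (isBoundedRoot_conj_omega_pow hb hc).two_le_mul_norm_one_sub

theorem MConst_le_two (hb : 2 ≤ b) : MConst b ≤ 2 := by
  refine csSup_le (nonempty_norm_one_sub hb) ?_
  rintro _ ⟨c, -, rfl⟩
  refine (norm_sub_le _ _).trans_eq ?_
  rw [norm_one, norm_conj_omega_pow]
  norm_num

theorem mul_geom_sum_div_eq {b M : ℝ} (hb : b ≠ 0) (hbM : b - M ≠ 0) (m : ℝ) (n : ℕ) :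
    m * ∑ j ∈ Finset.range n, (M / b) ^ j = b * m / (b - M) * (1 - (M / b) ^ n) := by
  rw [← mul_neg_geom_sum]
  field_simp

end Constants

section WalshBounds

variable {b k : ℕ}

theorem norm_iterate_prim_charProd_digitRoot_le (hb : 2 < b) (hk : k ≠ 0) (n : ℕ) (x : ℝ) :
    ‖prim^[n] (charProd b (digitRoot b k) (positionList b k)) x‖ ≤
      cell b (muPer b n k) / mConst b ^ n * (MConst b * (1 + b * mConst b / (b - MConst b) *
        (1 - (MConst b / b) ^ hammingWeight b k))) := by
  have : NeZero b := ⟨by omega⟩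
  have hM := MConst_le_two hb.le
  have hbR : (2 : ℝ) < b := mod_cast hb
  have hbound := norm_iterate_prim_charProd_le
    (isBoundedRoot_conj_omega_pow hb.le ⟨le_rfl, Nat.le_sub_one_of_lt hb.le⟩)
    (two_le_mul_mConst hb.le) hM (pairwise_cons_positionList b k) one_le_of_mem_cons_positionList
    (fun _ => isBoundedRoot_digitRoot hb.le) n x
  rwa [sumTake_positionList hk, length_positionList,
    mul_geom_sum_div_eq (by linarith) (by linarith)] at hbound

theorem norm_iterate_prim_charProd_digitRoot_two_le (hk : k ≠ 0) (n : ℕ) (x : ℝ) :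
    ‖prim^[n] (charProd 2 (digitRoot 2 k) (positionList 2 k)) x‖ ≤
      cell 2 (muPer 2 n k) / 2 ^ n * 2 := by
  rw [← sumTake_positionList hk n ((Nat.digits 2 k).length + 1)]
  exact norm_iterate_prim_charProd_two_le (pairwise_cons_positionList 2 k)
    one_le_of_mem_cons_positionList (fun _ => digitRoot_two) n x

end WalshBounds

end Walsh

end

theorem mainTheorem7_general (b α k : ℕ) (hb : 2 ≤ b) (hα : 1 ≤ α) (hk : 1 ≤ k) (f : ℝ → ℝ)
    (hac : ∀ i < α, AbsolutelyContinuousOnInterval (Walsh.der i f) 0 1)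
    (hint : ∀ i < α, ∫ x in (0 : ℝ)..1, Walsh.der i f x = 0) :
    (2 < b →
      ‖Walsh.coeff b k (fun x => (f x : ℂ))‖ ≤
        (∫ x in (0 : ℝ)..1, |Walsh.der α f x|) *
          ((b : ℝ) ^ (-(Walsh.muPer b α k : ℤ)) / Walsh.mConst b ^ α) *
          (Walsh.MConst b *
            (1 + (b : ℝ) * Walsh.mConst b / ((b : ℝ) - Walsh.MConst b) *
              (1 - (Walsh.MConst b / (b : ℝ)) ^ Walsh.hammingWeight b k)))) ∧
    (b = 2 →
      ‖Walsh.coeff b k (fun x => (f x : ℂ))‖ ≤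
        (∫ x in (0 : ℝ)..1, |Walsh.der α f x|) *
          ((2 : ℝ) ^ (-(Walsh.muPer b α k : ℤ)) / (2 : ℝ) ^ (α - 1))) := by
  have : NeZero b := ⟨by omega⟩
  have hk : k ≠ 0 := Nat.ne_of_gt hk
  refine ⟨fun hb2 => ?_, ?_⟩
  · rw [← Walsh.cell_eq_zpow, mul_assoc]
    exact Walsh.norm_coeff_le hα hac hint (Walsh.norm_iterate_prim_charProd_digitRoot_le hb2 hk α)
  · rintro rfl
    have hscale : (2 : ℝ) ^ (-(Walsh.muPer 2 α k : ℤ)) / 2 ^ (α - 1) =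
        Walsh.cell 2 (Walsh.muPer 2 α k) / 2 ^ α * 2 := by
      rw [Walsh.cell_eq_zpow, Nat.cast_ofNat, ← Nat.sub_add_cancel hα, pow_succ,
        Nat.add_sub_cancel]
      field_simp
    rw [hscale]
    exact Walsh.norm_coeff_le hα hac hint (Walsh.norm_iterate_prim_charProd_digitRoot_two_le hk α)

theorem mainTheorem7 (b α k : ℕ) (hb : 2 ≤ b) (hα : 1 ≤ α) (hk : 1 ≤ k)
    (f : ℝ → ℝ) (hf : Walsh.IsSobolevPer α f) :
    (2 < b →
      ‖Walsh.coeff b k (fun x => (f x : ℂ))‖ ≤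
        (∫ x in (0 : ℝ)..1, |Walsh.der α f x|) *
          ((b : ℝ) ^ (-(Walsh.muPer b α k : ℤ)) / Walsh.mConst b ^ α) *
          (Walsh.MConst b *
            (1 + (b : ℝ) * Walsh.mConst b / ((b : ℝ) - Walsh.MConst b) *
              (1 - (Walsh.MConst b / (b : ℝ)) ^ Walsh.hammingWeight b k)))) ∧
    (b = 2 →
      ‖Walsh.coeff b k (fun x => (f x : ℂ))‖ ≤
        (∫ x in (0 : ℝ)..1, |Walsh.der α f x|) *
          ((2 : ℝ) ^ (-(Walsh.muPer b α k : ℤ)) / (2 : ℝ) ^ (α - 1))) :=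
  mainTheorem7_general b α k hb hα hk f hf.absolutelyContinuous hf.integral_eq_zero
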